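/- Let $\delta\ge 0$ be an integer and let $S_\delta$ be the Hirzebruch surface, i.e. the quotient $\pi$ of $(\mathbb C^2\setminus\{0\})\times(\mathbb C^2\setminus\{0\})$, with coordinates $(X_0,X_1,Y_0,Y_1)$, by the action $(\lambda,\mu)\cdot(X_0,X_1,Y_0,Y_1)=(\lambda X_0,\lambda X_1,\mu Y_0,\lambda^{-\delta}\mu Y_1)$ of $(\mathbb C\setminus\{0\})^2$. A polynomial in $X_0,X_1,Y_0,Y_1$ is bi-homogeneous of bi-degree $(a,b)$ if each of its monomials $X_0^{\alpha}X_1^{\beta}Y_0^{\gamma}Y_1^{\varepsilon}$ satisfies $\alpha+\beta-\delta\varepsilon=a$ and $\gamma+\varepsilon=b$ (the zero polynomial is allowed); $\mathcal O(a,b)$ is the invertible sheaf whose sections over $U$ are the holomorphic functions $H$ on $\pi^{-1}(U)$ with $H((\lambda,\mu)\cdot p)=\lambda^a\mu^bH(p)$. For $i,j\in\{0,1\}$ put $i'=1-i$, $j'=1-j$, and let $U_{ij}=\{X_i\ne0,\ Y_j\neq 0\}\subset S_\delta$, identified with $\mathbb C^2$ by the coordinates $x_{ij}=X_{i'}/X_i$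 and $y_{i0}=X_i^{\delta}Y_1/Y_0$, $y_{i1}=X_i^{-\delta}Y_0/Y_1$. For $d_1,d_2\in\mathbb Z$ let $\mathrm{Fol}(\mathcal O(-d_1,-d_2),S_\delta)=\mathbb P H^0(S_\delta,\Theta_{S_\delta}\otimes\mathcal O(d_1,d_2))$ be the space of foliations with tangent sheaf $\mathcal O(-d_1,-d_2)$. A holomorphic $1$-form $\eta$ on $U_{ij}$ is said to define $\mathcal F=[s]$ on $U_{ij}$ if $\eta$ is, up to a nowhere vanishing holomorphic function, the contraction of $dx_{ij}\wedge dy_{ij}$ with the vector field that $s$ induces on $U_{ij}$. **Proposition.** Let $d_1,d_2\in\mathbb Z$ and let $\mathcal F=[s]\in\mathrm{Fol}(\mathcal O(-d_1,-d_2),S_\delta)$. There is a differential $1$-form $$\Omega=A_0\,dX_0+A_1\,dX_1+B_0\,dY_0+B_1\,dY_1$$ whose coefficients are polynomials, not all zero, bi-homogeneous of bi-degrees $(d_1-\delta+1,d_2+2)$ for $A_0$ and $A_1$, $(d_1-\delta+2,d_2+1)$ for $B_0$ and $(d_1+2,d_2+1)$ for $B_1$, with $$\Omega(R_1)=X_0A_0+X_1A_1-\delta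 Y_1B_1=0,\qquad \Omega(R_2)=Y_0B_0+Y_1B_1=0,$$ where $R_1=X_0\frac{\partial}{\partial X_0}+X_1\frac{\partial}{\partial X_1}-\delta Y_1\frac{\partial}{\partial Y_1}$ and $R_2=Y_0\frac{\partial}{\partial Y_0}+Y_1\frac{\partial}{\partial Y_1}$, which represents $\mathcal F$: up to a non-zero scalar, $\Omega$ is the pull-back under $\pi$ of the section of $\Omega^1_{S_\delta}\otimes\mathcal O(d_1+2-\delta,d_2+2)$ that annihilates $s$, i.e. the image of $s$ under the isomorphism $\Theta_{S_\delta}\otimes\mathcal O(d_1,d_2)\cong\Omega^1_{S_\delta}\otimes\mathcal O(d_1+2-\delta,d_2+2)$ given by contraction with $2$-forms. Moreover, for all $i,j\in\{0,1\}$ the $1$-form $$\Omega_{ij}=\tilde A_{i'}^{ij}\,dx_{ij}+\tilde B_{j'}^{ij}\,dy_{ij}$$ defines $\mathcal F$ on $U_{ij}$, where $\tilde H^{ij}(x_{ij},y_{ij})$ is obtained from $H$ by putting $X_i=Y_j=1$, $X_{i'}=x_{ij}$, $Y_{j'}=y_{ij}$. The form $\Omega$ is unique up to a non-zero scalar: a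 $1$-form $\Omega'$ satisfying the same conditions on its coefficients has all its local forms $\Omega'_{ij}$ defining $\mathcal F$ on $U_{ij}$ if and only if $\Omega'=c\,\Omega$ for some $c\in\mathbb C\setminus\{0\}$. And $\Omega$ determines $\mathcal F$: if $\mathcal F'\in\mathrm{Fol}(\mathcal O(-d_1,-d_2),S_\delta)$ is such that $\Omega_{ij}$ defines $\mathcal F'$ on $U_{ij}$ for all $i,j$, then $\mathcal F'=\mathcal F$. -/

import Mathlib

noncomputable section

namespace Hirzebruch

/-- The four variables `X₀, X₁` (as `Sum.inl 0, Sum.inl 1`) and `Y₀, Y₁` (as `Sum.inr 0, Sum.inr 1`). -/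
abbrev Var : Type := Fin 2 ⊕ Fin 2

/-- The polynomial ring `ℂ[X₀, X₁, Y₀, Y₁]`. -/
abbrev Poly : Type := MvPolynomial Var ℂ

/-- The variable `Y_j` has bi-degree `(wt δ j, 1)`, i.e. `Y₀` has bi-degree `(0, 1)` and `Y₁` has
bi-degree `(-δ, 1)`; both `X₀` and `X₁` have bi-degree `(1, 0)`. -/
def wt (δ : ℕ) (j : Fin 2) : ℤ := if j = 0 then 0 else -(δ : ℤ)

/-! ### The surface `S_δ` as a quotient of `(ℂ² ∖ 0) × (ℂ² ∖ 0)` -/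

/-- The space `(ℂ² ∖ 0) × (ℂ² ∖ 0)` on which the torus `ℂˣ × ℂˣ` acts (with weights depending
on `δ`). -/
@[ext]
structure Total (δ : ℕ) where
  /-- the coordinates `(X₀, X₁, Y₀, Y₁)` -/
  val : Var → ℂ
  X_ne : ∃ i, val (Sum.inl i) ≠ 0
  Y_ne : ∃ j, val (Sum.inr j) ≠ 0

/-- `(λ, μ) · (X₀, X₁, Y₀, Y₁) = (λ X₀, λ X₁, μ Y₀, λ^(-δ) μ Y₁)`. -/
instance (δ : ℕ) : MulAction (ℂˣ × ℂˣ) (Total δ) where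
  smul g p :=
    { val := Sum.elim (fun i => (g.1 : ℂ) * p.val (Sum.inl i))
        (fun j => (g.1 : ℂ) ^ (wt δ j) * (g.2 : ℂ) * p.val (Sum.inr j))
      X_ne := by
        obtain ⟨i, hi⟩ := p.X_ne
        exact ⟨i, by simpa using hi⟩
      Y_ne := by
        obtain ⟨j, hj⟩ := p.Y_ne
        exact ⟨j, by simpa [zpow_ne_zero] using hj⟩ }
  one_smul p := by
    apply Total.ext
    funext k
    change Sum.elim _ _ k = _
    rcases k with i | j <;> simp
  mul_smul g h p := by
    apply Total.ext
    funext k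
    change Sum.elim _ _ k = Sum.elim _ _ k
    rcases k with i | j
    · change _ = (g.1 : ℂ) * ((h.1 : ℂ) * p.val (Sum.inl i))
      simp [mul_assoc]
    · change _ = (g.1 : ℂ) ^ (wt δ j) * (g.2 : ℂ) *
        ((h.1 : ℂ) ^ (wt δ j) * (h.2 : ℂ) * p.val (Sum.inr j))
      simp only [Sum.elim_inr, Prod.fst_mul, Prod.snd_mul, Units.val_mul, mul_zpow]
      ring

theorem smul_inl {δ : ℕ} (g : ℂˣ × ℂˣ) (p : Total δ) (i : Fin 2) :
    (g • p).val (Sum.inl i) = (g.1 : ℂ) * p.val (Sum.inl i) := rfl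

theorem smul_inr {δ : ℕ} (g : ℂˣ × ℂˣ) (p : Total δ) (j : Fin 2) :
    (g • p).val (Sum.inr j) = (g.1 : ℂ) ^ (wt δ j) * (g.2 : ℂ) * p.val (Sum.inr j) := rfl

/-- The Hirzebruch surface `S_δ`, the quotient of `(ℂ² ∖ 0) × (ℂ² ∖ 0)` by the torus action. -/
abbrev Surface (δ : ℕ) : Type := MulAction.orbitRel.Quotient (ℂˣ × ℂˣ) (Total δ)

/-- The quotient map `π`. -/
def proj {δ : ℕ} (p : Total δ) : Surface δ := Quotient.mk _ p

/-- The affine open set `U_ij` of `S_δ`, given by `X_i ≠ 0` and `Y_j ≠ 0`. -/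
def affineOpen (δ : ℕ) (i j : Fin 2) : Set (Surface δ) :=
  {q | ∃ p : Total δ, proj p = q ∧ p.val (Sum.inl i) ≠ 0 ∧ p.val (Sum.inr j) ≠ 0}

theorem proj_mem_affineOpen {δ : ℕ} (i j : Fin 2) (p : Total δ) :
    proj p ∈ affineOpen δ i j ↔ p.val (Sum.inl i) ≠ 0 ∧ p.val (Sum.inr j) ≠ 0 := by
  refine ⟨?_, fun h => ⟨p, rfl, h⟩⟩
  rintro ⟨q, hq, hX, hY⟩
  obtain ⟨g, rfl⟩ := Quotient.exact hq
  simp only [smul_inl, smul_inr] at hX hY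
  exact ⟨right_ne_zero_of_mul hX, right_ne_zero_of_mul hY⟩

/-- The affine coordinates `(x_ij, y_ij)` as rational functions of `(X₀, X₁, Y₀, Y₁)`, with
`i' = i.rev`, `j' = j.rev` the other indices: `x_ij = X_i' / X_i` and
`y_ij = X_i ^ (wt j - wt j') * Y_j' / Y_j`, so `y_i0 = X_i ^ δ * Y₁ / Y₀` and
`y_i1 = X_i ^ (-δ) * Y₀ / Y₁`. -/
def ratCoord (δ : ℕ) (i j : Fin 2) (v : Var → ℂ) : ℂ × ℂ :=
  (v (Sum.inl i.rev) / v (Sum.inl i),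
    v (Sum.inl i) ^ (wt δ j - wt δ j.rev) * v (Sum.inr j.rev) / v (Sum.inr j))

/-- The point with `X_i = 1`, `X_i' = x`, `Y_j = 1`, `Y_j' = y`, where `(x, y) = z`. -/
def slice (i j : Fin 2) (z : ℂ × ℂ) : Var → ℂ :=
  Sum.elim (fun k => if k = i then 1 else z.1) (fun k => if k = j then 1 else z.2)

/-- `slice i j z` as a point of `(ℂ² ∖ 0) × (ℂ² ∖ 0)`. -/
def slicePoint (δ : ℕ) (i j : Fin 2) (z : ℂ × ℂ) : Total δ where
  val := slice i j z
  X_ne := ⟨i, by simp [slice]⟩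
  Y_ne := ⟨j, by simp [slice]⟩

theorem ratCoord_smul {δ : ℕ} (i j : Fin 2) (g : ℂˣ × ℂˣ) (p : Total δ) :
    ratCoord δ i j (g • p).val = ratCoord δ i j p.val := by
  have h1 : (g.1 : ℂ) ≠ 0 := g.1.ne_zero
  have h2 : (g.2 : ℂ) ≠ 0 := g.2.ne_zero
  have h3 : (g.1 : ℂ) ^ (wt δ j) ≠ 0 := zpow_ne_zero _ h1
  have h4 : (g.1 : ℂ) ^ (wt δ j.rev) ≠ 0 := zpow_ne_zero _ h1
  simp only [ratCoord, smul_inl, smul_inr, mul_zpow, zpow_sub₀ h1]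
  refine Prod.ext ?_ ?_
  · exact mul_div_mul_left _ _ h1
  · dsimp only
    by_cases hy : p.val (Sum.inr j) = 0
    · simp [hy]
    · field_simp

theorem rev_ne (i : Fin 2) : i.rev ≠ i := by
  revert i; decide

theorem eq_rev_of_ne {i k : Fin 2} (h : k ≠ i) : k = i.rev := by
  revert i k; decide

theorem ratCoord_slice (δ : ℕ) (i j : Fin 2) (z : ℂ × ℂ) : ratCoord δ i j (slice i j z) = z := by
  simp [ratCoord, slice, rev_ne]

/-- The chart `U_ij → ℂ²`, `π(X₀, X₁, Y₀, Y₁) ↦ (x_ij, y_ij)`, a bijection of `U_ij` with `ℂ²`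
whose inverse sends `z` to `π (slice i j z)`. -/
def chart (δ : ℕ) (i j : Fin 2) : PartialEquiv (Surface δ) (ℂ × ℂ) where
  toFun := Quotient.lift (fun p : Total δ => ratCoord δ i j p.val) (by
    rintro p q ⟨g, rfl⟩
    exact ratCoord_smul i j g q)
  invFun z := proj (slicePoint δ i j z)
  source := affineOpen δ i j
  target := Set.univ
  map_source' _ _ := Set.mem_univ _
  map_target' z _ := ⟨slicePoint δ i j z, rfl, by simp [slicePoint, slice],
    by simp [slicePoint, slice]⟩
  left_inv' := by
    rintro _ ⟨p, rfl, hX, hY⟩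
    have h3 : p.val (Sum.inl i) ^ (wt δ j) ≠ 0 := zpow_ne_zero _ hX
    have h4 : p.val (Sum.inl i) ^ (wt δ j.rev) ≠ 0 := zpow_ne_zero _ hX
    refine Quotient.sound ⟨((Units.mk0 _ hX)⁻¹,
      Units.mk0 (p.val (Sum.inl i) ^ (wt δ j) / p.val (Sum.inr j)) (div_ne_zero h3 hY)), ?_⟩
    apply Total.ext
    funext k
    change (_ • p : Total δ).val k = slice i j (ratCoord δ i j p.val) k
    rcases k with k | k
    · rw [smul_inl]
      rcases eq_or_ne k i with rfl | hk
      · simp [slice, hX]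
      · obtain rfl := eq_rev_of_ne hk
        simp [slice, rev_ne, ratCoord]
        field_simp
    · rw [smul_inr]
      rcases eq_or_ne k j with rfl | hk
      · simp [slice]
        field_simp
      · obtain rfl := eq_rev_of_ne hk
        simp [slice, rev_ne, ratCoord, zpow_sub₀ hX]
        field_simp
  right_inv' z _ := ratCoord_slice δ i j z

/-- The change of coordinates `φ` from `U_ij` to `U_kl`, in the affine coordinates. -/
def transition (δ : ℕ) (i j k l : Fin 2) (z : ℂ × ℂ) : ℂ × ℂ :=
  chart δ k l ((chart δ i j).symm z)

/-! ### Line bundles, twisted vector fields, foliations -/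

/-- The local frame of `𝒪(a, b)` over `U_ij`, as a function on `π⁻¹(U_ij)` of bi-degree `(a, b)`:
it is `X_i ^ (a - b * wt j) * Y_j ^ b`. (Sections of `𝒪(a, b)` over an open set `U` are the
holomorphic functions `H` on `π⁻¹(U)` with `H((λ, μ) · p) = λ ^ a * μ ^ b * H(p)`; the class of
`𝒪(a, b)` is `a F + b M`, where `X_i = 0` has class `F` and `Y₀ = 0` has class `M`.) -/
def frame (δ : ℕ) (a b : ℤ) (i j : Fin 2) (p : Total δ) : ℂ :=
  p.val (Sum.inl i) ^ (a - b * wt δ j) * p.val (Sum.inr j) ^ b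

theorem frame_smul {δ : ℕ} (a b : ℤ) (i j : Fin 2) (g : ℂˣ × ℂˣ) (p : Total δ) :
    frame δ a b i j (g • p) = (g.1 : ℂ) ^ a * (g.2 : ℂ) ^ b * frame δ a b i j p := by
  have h1 : (g.1 : ℂ) ≠ 0 := g.1.ne_zero
  have h : (g.1 : ℂ) ^ a = (g.1 : ℂ) ^ (a - b * wt δ j) * ((g.1 : ℂ) ^ (wt δ j)) ^ b := by
    rw [← zpow_mul, ← zpow_add₀ h1]
    congr 1
    ring
  simp only [frame, smul_inl, smul_inr, mul_zpow, h]
  ring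

/-- `H⁰(S_δ, Θ(d₁, d₂))`, the space of global holomorphic sections of the tangent bundle twisted
by `𝒪(d₁, d₂)`. A section is given by holomorphic vector fields `s i j = (a, b)`, meaning
`a ∂/∂x_ij + b ∂/∂y_ij`, on the affine open sets `U_ij ≅ ℂ²`, such that the local sections
`s i j ⊗ frame i j` agree on the overlaps. -/
def twistedFields (δ : ℕ) (d₁ d₂ : ℤ) : Submodule ℂ (Fin 2 → Fin 2 → ℂ × ℂ → ℂ × ℂ) where
  carrier := {s | (∀ i j, Differentiable ℂ (s i j)) ∧
    ∀ (i j k l : Fin 2) (p : Total δ), proj p ∈ affineOpen δ i j ∩ affineOpen δ k l →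
      frame δ d₁ d₂ i j p •
          fderiv ℂ (transition δ i j k l) (chart δ i j (proj p)) (s i j (chart δ i j (proj p))) =
        frame δ d₁ d₂ k l p • s k l (chart δ k l (proj p))}
  zero_mem' := ⟨fun _ _ => differentiable_const _, fun i j k l p _ => by simp⟩
  add_mem' := by
    rintro s t ⟨hs, hs'⟩ ⟨ht, ht'⟩
    refine ⟨fun i j => (hs i j).add (ht i j), fun i j k l p hp => ?_⟩
    simp only [Pi.add_apply, map_add, smul_add, hs' i j k l p hp, ht' i j k l p hp]
  smul_mem' := by
    rintro c s ⟨hs, hs'⟩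
    refine ⟨fun i j => (hs i j).const_smul c, fun i j k l p hp => ?_⟩
    simp only [Pi.smul_apply, map_smul, smul_comm _ c, hs' i j k l p hp]

/-- `Fol(𝒪(-d₁, -d₂), S_δ) = ℙ H⁰(S_δ, Θ(d₁, d₂))`, the foliations on `S_δ` with tangent sheaf
`𝒪(-d₁, -d₂)`. -/
abbrev Fol (δ : ℕ) (d₁ d₂ : ℤ) : Type := Projectivization ℂ (twistedFields δ d₁ d₂)

/-! ### Differential forms -/

/-- The contraction `ι_w (dx ∧ dy) = w₁ dy - w₂ dx` on `ℂ²`. -/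
def contractArea (w : ℂ × ℂ) : ℂ × ℂ →L[ℂ] ℂ :=
  w.1 • ContinuousLinearMap.snd ℂ ℂ ℂ - w.2 • ContinuousLinearMap.fst ℂ ℂ ℂ

/-- The holomorphic `1`-form `η` on `U_ij` (in the affine coordinates) defines the foliation `F`
on `U_ij`: up to a nowhere vanishing holomorphic function, `η` is `ι_X (dx ∧ dy)`, where `X` is the
vector field on `U_ij` of a section giving `F`. In particular `η(X) = 0`, and `η` and `X` have
the same zero scheme. -/
def DefinesOn {δ : ℕ} {d₁ d₂ : ℤ} (F : Fol δ d₁ d₂) (i j : Fin 2)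
    (η : ℂ × ℂ → (ℂ × ℂ →L[ℂ] ℂ)) : Prop :=
  ∃ u : ℂ × ℂ → ℂ, Differentiable ℂ u ∧ (∀ z, u z ≠ 0) ∧
    ∀ z, η z = u z • contractArea (F.rep.1 i j z)

/-- A polynomial `1`-form `Ω = A₀ dX₀ + A₁ dX₁ + B₀ dY₀ + B₁ dY₁`, given by its coefficients
`A_i = Ω (Sum.inl i)` and `B_j = Ω (Sum.inr j)`. -/
abbrev AffineForm : Type := Var → Poly

/-- Every monomial `X₀^α X₁^β Y₀^γ Y₁^ε` of `H` has `α + β - δ ε = a` and `γ + ε = b`. -/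
def IsBihomogeneous (δ : ℕ) (a b : ℤ) (H : Poly) : Prop :=
  ∀ m : Var →₀ ℕ, H.coeff m ≠ 0 →
    (m (Sum.inl 0) : ℤ) + m (Sum.inl 1) - δ * m (Sum.inr 1) = a ∧
      (m (Sum.inr 0) : ℤ) + m (Sum.inr 1) = b

/-- The value `Ω(V)` of a polynomial `1`-form on a polynomial vector field. -/
def contract (Ω : AffineForm) (V : Var → Poly) : Poly := ∑ k, Ω k * V k

/-- The radial field `R₁ = X₀ ∂/∂X₀ + X₁ ∂/∂X₁ - δ Y₁ ∂/∂Y₁`. -/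
def radial₁ (δ : ℕ) : Var → Poly :=
  Sum.elim (fun i => MvPolynomial.X (Sum.inl i))
    ![0, -(δ : Poly) * MvPolynomial.X (Sum.inr 1)]

/-- The radial field `R₂ = Y₀ ∂/∂Y₀ + Y₁ ∂/∂Y₁`. -/
def radial₂ : Var → Poly :=
  Sum.elim (fun _ => 0) (fun j => MvPolynomial.X (Sum.inr j))

/-- The conditions on the affine form attached to a foliation with tangent sheaf
`𝒪(-d₁, -d₂)`: not zero, coefficients of the prescribed bi-degrees, and `Ω(R₁) = Ω(R₂) = 0`. -/
structure IsFoliationForm (δ : ℕ) (d₁ d₂ : ℤ) (Ω : AffineForm) : Prop where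
  ne_zero : Ω ≠ 0
  A₀ : IsBihomogeneous δ (d₁ - δ + 1) (d₂ + 2) (Ω (Sum.inl 0))
  A₁ : IsBihomogeneous δ (d₁ - δ + 1) (d₂ + 2) (Ω (Sum.inl 1))
  B₀ : IsBihomogeneous δ (d₁ - δ + 2) (d₂ + 1) (Ω (Sum.inr 0))
  B₁ : IsBihomogeneous δ (d₁ + 2) (d₂ + 1) (Ω (Sum.inr 1))
  radial₁ : contract Ω (radial₁ δ) = 0
  radial₂ : contract Ω radial₂ = 0

/-- The value of `Ω` at the point `v` of `ℂ⁴` on the tangent vector `w`. -/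
def evalForm (Ω : AffineForm) (v w : Var → ℂ) : ℂ := ∑ k, MvPolynomial.eval v (Ω k) * w k

/-- `Ω` represents `F = [s]`: on each `π⁻¹(U_ij)` it is the pull-back under `π` of the twisted
`1`-form in `H⁰(S_δ, Ω¹(d₁ + 2 - δ, d₂ + 2))` that annihilates `s`. Over `U_ij` the latter is
`(-1)^(i+j) ι_X (dx_ij ∧ dy_ij) ⊗ frame i j`, with `X = s i j`; the signs come from the isomorphism
of `Λ² Ω¹` with `𝒪(δ - 2, -2)`, under which `dx_ij ∧ dy_ij` is `(-1)^(i+j) frame i j`. -/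
def Represents {δ : ℕ} {d₁ d₂ : ℤ} (Ω : AffineForm) (F : Fol δ d₁ d₂) : Prop :=
  ∃ (s : twistedFields δ d₁ d₂) (hs : s ≠ 0), Projectivization.mk ℂ s hs = F ∧
    ∀ (i j : Fin 2) (p : Total δ), proj p ∈ affineOpen δ i j → ∀ w : Var → ℂ,
      evalForm Ω p.val w = (-1) ^ (i.val + j.val) * frame δ (d₁ + 2 - δ) (d₂ + 2) i j p *
        contractArea (s.1 i j (chart δ i j (proj p))) (fderiv ℂ (ratCoord δ i j) p.val w)

/-- The function `H̃^ij` on `U_ij ≅ ℂ²`, obtained from `H` by putting `X_i = Y_j = 1`, `X_i' = x_ij`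
and `Y_j' = y_ij`. -/
def dehom (i j : Fin 2) (H : Poly) (z : ℂ × ℂ) : ℂ := MvPolynomial.eval (slice i j z) H

/-- The `1`-form `Ã_i' dx_ij + B̃_j' dy_ij` on `U_ij ≅ ℂ²`, where `i' ≠ i` and `j' ≠ j`. -/
def localForm (Ω : AffineForm) (i j : Fin 2) (z : ℂ × ℂ) : ℂ × ℂ →L[ℂ] ℂ :=
  dehom i j (Ω (Sum.inl i.rev)) z • ContinuousLinearMap.fst ℂ ℂ ℂ +
    dehom i j (Ω (Sum.inr j.rev)) z • ContinuousLinearMap.snd ℂ ℂ ℂ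

theorem contract_radial₁ (δ : ℕ) (Ω : AffineForm) :
    contract Ω (radial₁ δ) = MvPolynomial.X (Sum.inl 0) * Ω (Sum.inl 0) +
      MvPolynomial.X (Sum.inl 1) * Ω (Sum.inl 1) -
        (δ : Poly) * MvPolynomial.X (Sum.inr 1) * Ω (Sum.inr 1) := by
  simp [contract, radial₁]
  ring

theorem contract_radial₂ (Ω : AffineForm) :
    contract Ω radial₂ = MvPolynomial.X (Sum.inr 0) * Ω (Sum.inr 0) +
      MvPolynomial.X (Sum.inr 1) * Ω (Sum.inr 1) := by
  simp [contract, radial₂]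
  ring

end Hirzebruch

end

namespace Hirzebruch

open Finset

/-! Contraction with 2-forms turns `s` into a twisted 1-form, and what must be shown is that its
pull-back has polynomial coefficients. On (ℂ²∖0)² the local expressions `pulledForm` glue: up to
sign, the frame of 𝒪(2 - δ, 2) times the pull-back of dx ∧ dy is `radialArea`, the contraction of
dX₀ ∧ dX₁ ∧ dY₀ ∧ dY₁ with the two radial fields, which does not depend on the chart
(`frame_mul_contractArea_ratCoordDeriv`, `pulledForm_eq`). The values of the glued form on the
coordinate vectors are global sections of line bundles, and `IsGlobalSection.exists_polynomial` says
that such sections are bi-homogeneous polynomials; its analytic core is Cauchy's estimate, applied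
in y and then in x. The radial fields are killed because they are tangent to the fibres of π.

For uniqueness, the two radial relations and homogeneity recover all four coefficients from a local
form. Hence local proportionality factors of two foliation forms agree on overlaps and form a global
section of 𝒪(0, 0), which is a constant (`IsFoliationForm.exists_eq_smul`). The same statement,
applied to the forms of two foliations, shows that Ω determines the foliation. -/

/-! ### Entire functions of polynomial growth and families of polynomials -/

/-- An entire function `f` with `f y = y ^ n * g (1 / y)`, where `g` is continuous at `0`, is a
polynomial of degree at most `n`. -/
theorem exists_sum_of_eq_zpow_mul_inv {f g : ℂ → ℂ} (hf : Differentiable ℂ f)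
    (hg : ContinuousAt g 0) (n : ℤ) (h : ∀ y, y ≠ 0 → f y = y ^ n * g y⁻¹) :
    ∃ c : ℕ → ℂ, ∀ y, f y = ∑ k ∈ range (n + 1).toNat, c k * y ^ k := by
  have hzero : ∀ k : ℕ, (n + 1).toNat ≤ k → iteratedDeriv k f 0 = 0 := by
    intro k hk
    have hnk : n + 1 ≤ k := by omega
    have hb : ∀ᶠ t in nhds (0 : ℂ), ‖g t‖ ≤ ‖g 0‖ + 1 :=
      hg.norm.eventually (Iic_mem_nhds (by linarith : ‖g 0‖ < ‖g 0‖ + 1))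
    obtain ⟨r, hr, hb⟩ := Metric.eventually_nhds_iff.1 hb
    -- Cauchy's estimate on |z| = R: there |f| ≤ R ^ n * (‖g 0‖ + 1) once 1 / R < r, and k ≥ n + 1
    -- leaves a factor of at most R⁻¹.
    have key : ∀ᶠ R : ℝ in Filter.atTop,
        ‖iteratedDeriv k f 0‖ ≤ k.factorial * (‖g 0‖ + 1) * R⁻¹ := by
      filter_upwards [Filter.eventually_gt_atTop 1, Filter.eventually_gt_atTop r⁻¹] with R h1 h2
      have hR : 0 < R := by linarith
      have := Complex.norm_iteratedDeriv_le_of_forall_mem_sphere_norm_le (c := 0)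
        (C := R ^ n * (‖g 0‖ + 1)) k hR hf.diffContOnCl (by
          intro z hz
          have hz : ‖z‖ = R := by simpa using hz
          have hz0 : z ≠ 0 := by
            rintro rfl
            simp at hz
            linarith
          rw [h z hz0, norm_mul, norm_zpow, hz]
          gcongr
          apply hb
          rw [dist_zero_right, norm_inv, hz]
          exact inv_lt_of_inv_lt₀ hr h2)
      refine this.trans ?_
      have h3 : R ^ n / R ^ k ≤ R⁻¹ := by
        rw [← zpow_natCast R k, ← zpow_sub₀ hR.ne', ← zpow_neg_one]
        exact zpow_le_zpow_right₀ h1.le (by omega)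
      calc (k.factorial : ℝ) * (R ^ n * (‖g 0‖ + 1)) / R ^ k
          = k.factorial * (‖g 0‖ + 1) * (R ^ n / R ^ k) := by ring
        _ ≤ _ := by gcongr
    have lim : Filter.Tendsto (fun R : ℝ => k.factorial * (‖g 0‖ + 1) * R⁻¹) Filter.atTop
        (nhds 0) := by
      simpa using tendsto_inv_atTop_zero.const_mul ((k.factorial : ℝ) * (‖g 0‖ + 1))
    exact norm_le_zero_iff.1 (ge_of_tendsto lim key)
  refine ⟨fun k => (k.factorial : ℂ)⁻¹ * iteratedDeriv k f 0, fun y => ?_⟩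
  rw [← Complex.taylorSeries_eq_of_entire' 0 y hf, tsum_eq_sum (s := range (n + 1).toNat)]
  · simp
  · intro k hk
    rw [hzero k (by simpa using hk)]
    simp

theorem degree_sum_monomial_lt (N : ℕ) (c : ℕ → ℂ) :
    (∑ k ∈ range N, Polynomial.monomial k (c k)).degree < N := by
  rw [← Polynomial.mem_degreeLT]
  refine Submodule.sum_mem _ fun k hk => ?_
  rw [Polynomial.mem_degreeLT]
  exact (Polynomial.degree_monomial_le _ _).trans_lt (by exact_mod_cast mem_range.1 hk)

theorem coeff_sum_monomial {N k : ℕ} (hk : k < N) (c : ℕ → ℂ) :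
    (∑ l ∈ range N, Polynomial.monomial l (c l)).coeff k = c k := by
  simp [Polynomial.coeff_monomial, hk]

theorem coeff_eq_of_sum_eq {N : ℕ} {c c' : ℕ → ℂ}
    (h : ∀ y : ℂ, ∑ k ∈ range N, c k * y ^ k = ∑ k ∈ range N, c' k * y ^ k) {k : ℕ}
    (hk : k < N) : c k = c' k := by
  have : (∑ l ∈ range N, Polynomial.monomial l (c l)) =
      ∑ l ∈ range N, Polynomial.monomial l (c' l) := by
    refine Polynomial.funext fun y => ?_
    simpa [Polynomial.eval_finsetSum] using h y
  rw [← coeff_sum_monomial hk c, this, coeff_sum_monomial hk]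

/-- The coefficients of a holomorphic family of polynomials of bounded degree are holomorphic. -/
theorem exists_differentiable_coeff {f : ℂ × ℂ → ℂ} (hf : Differentiable ℂ f) (N : ℕ)
    (h : ∀ x, ∃ c : ℕ → ℂ, ∀ y, f (x, y) = ∑ k ∈ range N, c k * y ^ k) :
    ∃ c : ℕ → ℂ → ℂ, (∀ k, Differentiable ℂ (c k)) ∧
      ∀ x y, f (x, y) = ∑ k ∈ range N, c k x * y ^ k := by
  -- Interpolation at the nodes 0, …, N - 1 writes each coefficient as a fixed linear combination of
  -- the values f (x, m), which are holomorphic in x.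
  refine ⟨fun k x => (Lagrange.interpolate (range N) (fun m : ℕ => (m : ℂ))
    (fun m => f (x, m))).coeff k, fun k => ?_, fun x y => ?_⟩
  · simp only [Lagrange.interpolate_apply, Polynomial.finsetSum_coeff, Polynomial.coeff_C_mul]
    fun_prop
  · obtain ⟨c, hc⟩ := h x
    have hP := Lagrange.eq_interpolate_of_eval_eq (s := range N) (v := fun m : ℕ => (m : ℂ))
      (r := fun m => f (x, m)) (f := ∑ k ∈ range N, Polynomial.monomial k (c k))
      (fun a _ b _ hab => Nat.cast_injective hab)
      (by simpa using degree_sum_monomial_lt N c)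
      (fun i _ => by simp [Polynomial.eval_finsetSum, hc])
    rw [hc]
    dsimp only
    rw [← hP]
    exact sum_congr rfl fun k hk => by rw [coeff_sum_monomial (mem_range.1 hk)]

/-! ### Global sections of 𝒪(a, b) are bi-homogeneous polynomials -/

theorem IsBihomogeneous.eval_smul {δ : ℕ} {a b : ℤ} {H : Poly} (hH : IsBihomogeneous δ a b H)
    (g : ℂˣ × ℂˣ) (p : Total δ) :
    MvPolynomial.eval (g • p).val H =
      (g.1 : ℂ) ^ a * (g.2 : ℂ) ^ b * MvPolynomial.eval p.val H := by
  have h1 : (g.1 : ℂ) ≠ 0 := g.1.ne_zero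
  have h2 : (g.2 : ℂ) ≠ 0 := g.2.ne_zero
  rw [MvPolynomial.eval_eq', MvPolynomial.eval_eq', mul_sum]
  refine sum_congr rfl fun m hm => ?_
  obtain ⟨ha, hb⟩ := hH m (MvPolynomial.mem_support_iff.1 hm)
  have ha' : a = (m (Sum.inl 0) : ℤ) + m (Sum.inl 1) + -(δ : ℤ) * m (Sum.inr 1) := by
    rw [← ha]; ring
  rw [ha', ← hb]
  simp only [Fintype.prod_sum_type, Fin.prod_univ_two, smul_inl, smul_inr, wt, mul_pow,
    zpow_add₀ h1, zpow_add₀ h2, zpow_natCast, zpow_mul]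
  simp
  ring

theorem slicePoint_zero_eq_smul {δ : ℕ} (i : Fin 2) {x y : ℂ} (hy : y ≠ 0) :
    slicePoint δ i 0 (x, y) = ((1 : ℂˣ), Units.mk0 y hy) • slicePoint δ i 1 (x, y⁻¹) := by
  apply Total.ext
  funext k
  rcases k with k | k
  · rw [smul_inl]; simp [slicePoint, slice]
  · rw [smul_inr]; fin_cases k <;> simp [slicePoint, slice, hy]

/-- The weight -δ of Y₁ makes y change to x ^ δ * y; this is why the coefficient of y ^ k has degree
bound a + δ k in x rather than a. -/
theorem slicePoint_zero_zero_eq_smul {δ : ℕ} {x : ℂ} (y : ℂ) (hx : x ≠ 0) :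
    slicePoint δ 0 0 (x, y) = (Units.mk0 x hx, (1 : ℂˣ)) •
      slicePoint δ 1 0 (x⁻¹, x ^ δ * y) := by
  apply Total.ext
  funext k
  rcases k with k | k
  · rw [smul_inl]; fin_cases k <;> simp [slicePoint, slice, hx]
  · rw [smul_inr]; fin_cases k <;> simp [slicePoint, slice, hx, wt]

theorem chart_proj {δ : ℕ} (i j : Fin 2) (p : Total δ) :
    chart δ i j (proj p) = ratCoord δ i j p.val := rfl

theorem exists_smul_slicePoint {δ : ℕ} {i j : Fin 2} {p : Total δ}
    (hp : proj p ∈ affineOpen δ i j) :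
    ∃ g : ℂˣ × ℂˣ, g • slicePoint δ i j (ratCoord δ i j p.val) = p := by
  have : proj (slicePoint δ i j (ratCoord δ i j p.val)) = proj p := (chart δ i j).left_inv hp
  exact Quotient.exact this.symm

theorem exists_mem_affineOpen {δ : ℕ} (p : Total δ) : ∃ i j, proj p ∈ affineOpen δ i j := by
  obtain ⟨i, hi⟩ := p.X_ne
  obtain ⟨j, hj⟩ := p.Y_ne
  exact ⟨i, j, p, rfl, hi, hj⟩

/-- `H` is a global section of `𝒪(a, b)`. -/
structure IsGlobalSection (δ : ℕ) (a b : ℤ) (H : Total δ → ℂ) : Prop where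
  smul : ∀ (g : ℂˣ × ℂˣ) (p : Total δ), H (g • p) = (g.1 : ℂ) ^ a * (g.2 : ℂ) ^ b * H p
  differentiable : ∀ i j, Differentiable ℂ fun z => H (slicePoint δ i j z)

theorem IsBihomogeneous.sum {δ : ℕ} {a b : ℤ} {ι : Type*} (s : Finset ι) (H : ι → Poly)
    (h : ∀ k ∈ s, IsBihomogeneous δ a b (H k)) : IsBihomogeneous δ a b (∑ k ∈ s, H k) := by
  intro m hm
  rw [MvPolynomial.coeff_sum] at hm
  obtain ⟨k, hk, hne⟩ := exists_ne_zero_of_sum_ne_zero hm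
  exact h k hk m hne

/-- The exponent of `X₀ ^ α * X₁ ^ β * Y₀ ^ γ * Y₁ ^ ε`. -/
noncomputable def exponent (α β γ ε : ℕ) : Var →₀ ℕ :=
  Finsupp.equivFunOnFinite.symm (Sum.elim ![α, β] ![γ, ε])

theorem isBihomogeneous_monomial {δ : ℕ} {a b : ℤ} {α β γ ε : ℕ} (c : ℂ)
    (h1 : (α : ℤ) + β - δ * ε = a) (h2 : (γ : ℤ) + ε = b) :
    IsBihomogeneous δ a b (MvPolynomial.monomial (exponent α β γ ε) c) := by
  intro m hm
  rw [MvPolynomial.coeff_monomial] at hm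
  obtain rfl : exponent α β γ ε = m := by
    by_contra hne
    simp [hne] at hm
  simpa [exponent] using ⟨h1, h2⟩

theorem eval_monomial_exponent (v : Var → ℂ) (α β γ ε : ℕ) (c : ℂ) :
    MvPolynomial.eval v (MvPolynomial.monomial (exponent α β γ ε) c) =
      c * (v (Sum.inl 0) ^ α * v (Sum.inl 1) ^ β * (v (Sum.inr 0) ^ γ * v (Sum.inr 1) ^ ε)) := by
  rw [MvPolynomial.eval_monomial, Finsupp.prod_fintype _ _ (by simp)]
  simp [Fintype.prod_sum_type, Fin.prod_univ_two, exponent]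

theorem differentiable_eval (H : Poly) : Differentiable ℂ fun v : Var → ℂ =>
    MvPolynomial.eval v H := by
  simp only [MvPolynomial.eval_eq']
  fun_prop

theorem differentiable_slice (i j : Fin 2) : Differentiable ℂ (slice i j) := by
  rw [differentiable_pi]
  rintro (k | k)
  · by_cases h : k = i <;> simp [slice, h]
  · by_cases h : k = j <;> simp [slice, h]

theorem differentiable_dehom (i j : Fin 2) (H : Poly) : Differentiable ℂ (dehom i j H) :=
  (differentiable_eval H).comp (differentiable_slice i j)

/-- Equivariance carries the equality to π⁻¹(U₀₀), which contains the points with both coordinates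
non-zero of every slice. These are dense in the slice, so continuity and equivariance give the rest.
-/
theorem IsGlobalSection.eq_of_eq_slice_zero {δ : ℕ} {a b : ℤ} {H H' : Total δ → ℂ}
    (hH : IsGlobalSection δ a b H) (hH' : IsGlobalSection δ a b H')
    (h : ∀ z, H (slicePoint δ 0 0 z) = H' (slicePoint δ 0 0 z)) : H = H' := by
  have open_eq : ∀ p, proj p ∈ affineOpen δ 0 0 → H p = H' p := by
    intro p hp
    obtain ⟨g, hg⟩ := exists_smul_slicePoint hp
    rw [← hg, hH.smul, hH'.smul, h]
  have slice_eq : ∀ i j z, H (slicePoint δ i j z) = H' (slicePoint δ i j z) := by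
    intro i j z
    have hd : Dense ({0}ᶜ ×ˢ {0}ᶜ : Set (ℂ × ℂ)) :=
      (dense_compl_singleton 0).prod (dense_compl_singleton 0)
    refine congrFun (Continuous.ext_on hd (hH.differentiable i j).continuous
      (hH'.differentiable i j).continuous ?_) z
    rintro ⟨x, y⟩ ⟨hx, hy⟩
    refine open_eq _ ((proj_mem_affineOpen 0 0 _).2 ⟨?_, ?_⟩)
    · by_cases h0 : 0 = i
      · simp [slicePoint, slice, h0]
      · simpa [slicePoint, slice, h0] using hx
    · by_cases h0 : 0 = j
      · simp [slicePoint, slice, h0]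
      · simpa [slicePoint, slice, h0] using hy
  funext p
  obtain ⟨i, j, hp⟩ := exists_mem_affineOpen p
  obtain ⟨g, hg⟩ := exists_smul_slicePoint hp
  rw [← hg, hH.smul, hH'.smul, slice_eq]

theorem IsBihomogeneous.isGlobalSection {δ : ℕ} {a b : ℤ} {P : Poly}
    (hP : IsBihomogeneous δ a b P) :
    IsGlobalSection δ a b fun p => MvPolynomial.eval p.val P :=
  ⟨hP.eval_smul, fun i j => differentiable_dehom i j P⟩

/-- Every global section of `𝒪(a, b)` is a bi-homogeneous polynomial. -/
theorem IsGlobalSection.exists_polynomial {δ : ℕ} {a b : ℤ} {H : Total δ → ℂ}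
    (hH : IsGlobalSection δ a b H) :
    ∃ P : Poly, IsBihomogeneous δ a b P ∧ ∀ p, MvPolynomial.eval p.val P = H p := by
  set N := (b + 1).toNat with hN
  -- For fixed x, passing from U_i0 to U_i1 bounds the degree in y by b. For negative b the sum is
  -- empty.
  have hy : ∀ i, ∃ c : ℕ → ℂ → ℂ, (∀ k, Differentiable ℂ (c k)) ∧
      ∀ x y, H (slicePoint δ i 0 (x, y)) = ∑ k ∈ range N, c k x * y ^ k := by
    intro i
    refine exists_differentiable_coeff (hH.differentiable i 0) N fun x => ?_
    refine exists_sum_of_eq_zpow_mul_inv (f := fun y => H (slicePoint δ i 0 (x, y)))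
      (g := fun y => H (slicePoint δ i 1 (x, y))) ?_ ?_ b ?_
    · exact (hH.differentiable i 0).comp (by fun_prop : Differentiable ℂ fun y : ℂ => (x, y))
    · exact ((hH.differentiable i 1).comp
        (by fun_prop : Differentiable ℂ fun y : ℂ => (x, y))).continuous.continuousAt
    · intro y hy
      rw [slicePoint_zero_eq_smul i hy, hH.smul]
      simp
  obtain ⟨c, hc, hcH⟩ := hy 0
  obtain ⟨c', hc', hcH'⟩ := hy 1
  -- Comparing coefficients of y ^ k on U₀₀ and U₁₀ gives c k x = x ^ (a + δ k) * c' k x⁻¹, so the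
  -- one-variable growth lemma applies again, now in x.
  have hx : ∀ k, ∃ e : ℕ → ℂ, k < N →
      ∀ x, c k x = ∑ l ∈ range (a + δ * k + 1).toNat, e l * x ^ l := by
    intro k
    by_cases hk : k < N
    · obtain ⟨e, he⟩ := exists_sum_of_eq_zpow_mul_inv (hc k)
        (hc' k).continuous.continuousAt (a + δ * k) (by
          intro x hx
          refine coeff_eq_of_sum_eq (N := N) (c := fun k => c k x)
            (c' := fun k => x ^ (a + δ * k : ℤ) * c' k x⁻¹) (fun y => ?_) hk
          rw [← hcH, slicePoint_zero_zero_eq_smul y hx, hH.smul, hcH', mul_sum]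
          refine sum_congr rfl fun m _ => ?_
          rw [zpow_add₀ hx, zpow_mul, mul_pow]
          simp
          ring)
      exact ⟨e, fun _ => he⟩
    -- A dummy value, so that `e` can be chosen for all `k`.
    · exact ⟨0, fun h => absurd h hk⟩
  choose e he using hx
  have hP : IsBihomogeneous δ a b (∑ k ∈ range N, ∑ l ∈ range (a + δ * k + 1).toNat,
      MvPolynomial.monomial
        (exponent ((a + δ * k).toNat - l) l (b.toNat - k) k) (e k l)) := by
    refine IsBihomogeneous.sum _ _ fun k hk => IsBihomogeneous.sum _ _ fun l hl =>
      isBihomogeneous_monomial _ ?_ ?_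
    · rw [mem_range] at hl
      set u := a + (δ : ℤ) * k with hu
      -- Since l < (u + 1).toNat, u is non-negative and l ≤ u, so the truncated subtraction is
      -- exact.
      have : (((u.toNat - l : ℕ) : ℤ)) + l = u := by omega
      rw [this, hu]
      ring
    · rw [mem_range] at hk
      omega
  refine ⟨_, hP, congrFun (IsGlobalSection.eq_of_eq_slice_zero hP.isGlobalSection hH ?_)⟩
  rintro ⟨x, y⟩
  rw [hcH]
  simp only [map_sum, eval_monomial_exponent]
  refine sum_congr rfl fun k hk => ?_
  rw [he k (mem_range.1 hk), sum_mul]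
  exact sum_congr rfl fun l _ => by simp [slicePoint, slice, mul_assoc]

/-! ### The differential of π in coordinates and the canonical bundle -/

/-- The differential of `ratCoord δ i j` at `v`, evaluated on the tangent vector `w`. -/
noncomputable def ratCoordDeriv (δ : ℕ) (i j : Fin 2) (v w : Var → ℂ) : ℂ × ℂ :=
  ((w (Sum.inl i.rev) * v (Sum.inl i) - v (Sum.inl i.rev) * w (Sum.inl i)) / v (Sum.inl i) ^ 2,
    v (Sum.inl i) ^ (wt δ j - wt δ j.rev) *
      (w (Sum.inr j.rev) / v (Sum.inr j) -
        v (Sum.inr j.rev) * w (Sum.inr j) / v (Sum.inr j) ^ 2 +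
        ((wt δ j - wt δ j.rev : ℤ) : ℂ) * v (Sum.inr j.rev) * w (Sum.inl i) /
          (v (Sum.inr j) * v (Sum.inl i))))

theorem differentiableAt_ratCoord (δ : ℕ) {i j : Fin 2} {v : Var → ℂ}
    (hX : v (Sum.inl i) ≠ 0) (hY : v (Sum.inr j) ≠ 0) :
    DifferentiableAt ℂ (ratCoord δ i j) v := by
  have hX' : DifferentiableAt ℂ (fun v : Var → ℂ => v (Sum.inl i) ^ (wt δ j - wt δ j.rev)) v :=
    (by fun_prop : DifferentiableAt ℂ (fun v : Var → ℂ => v (Sum.inl i)) v).zpow (Or.inl hX)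
  unfold ratCoord
  fun_prop (disch := assumption)

theorem fderiv_ratCoord (δ : ℕ) {i j : Fin 2} {v : Var → ℂ}
    (hX : v (Sum.inl i) ≠ 0) (hY : v (Sum.inr j) ≠ 0) (w : Var → ℂ) :
    fderiv ℂ (ratCoord δ i j) v w = ratCoordDeriv δ i j v w := by
  rw [← (differentiableAt_ratCoord δ hX hY).lineDeriv_eq_fderiv]
  refine HasLineDerivAt.lineDeriv ?_
  have hd : ∀ k, HasDerivAt (fun t : ℂ => v k + t * w k) (w k) 0 := fun k => by
    simpa using ((hasDerivAt_id (0 : ℂ)).mul_const (w k)).const_add (v k)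
  have hz := (hasDerivAt_zpow (wt δ j - wt δ j.rev) (v (Sum.inl i) + 0 * w (Sum.inl i))
    (Or.inl (by simpa using hX))).comp (0 : ℂ) (hd (Sum.inl i))
  have h1 := (hd (Sum.inl i.rev)).div (hd (Sum.inl i)) (by simpa using hX)
  have h2 := (hz.mul (hd (Sum.inr j.rev))).div (hd (Sum.inr j)) (by simpa using hY)
  have h := h1.prodMk h2
  refine HasDerivAt.congr_deriv (f := fun t => ratCoord δ i j (v + t • w)) h ?_
  simp only [ratCoordDeriv, zero_mul, add_zero, Function.comp_apply, Pi.mul_apply,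
    zpow_sub_one₀ hX]
  refine Prod.ext rfl ?_
  dsimp only
  field_simp
  ring

theorem contractArea_apply (w w' : ℂ × ℂ) : contractArea w w' = w.1 * w'.2 - w.2 * w'.1 := rfl

theorem contractArea_smul (c : ℂ) (w : ℂ × ℂ) : contractArea (c • w) = c • contractArea w := by
  ext <;> simp [contractArea]

/-- The contraction of `dX₀ ∧ dX₁ ∧ dY₀ ∧ dY₁` with the two radial fields, at the point `v`. -/
noncomputable def radialArea (δ : ℕ) (v w w' : Var → ℂ) : ℂ :=
  (v (Sum.inl 0) * w (Sum.inl 1) - v (Sum.inl 1) * w (Sum.inl 0)) *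
      (v (Sum.inr 0) * w' (Sum.inr 1) - v (Sum.inr 1) * w' (Sum.inr 0)) -
    (v (Sum.inl 0) * w' (Sum.inl 1) - v (Sum.inl 1) * w' (Sum.inl 0)) *
      (v (Sum.inr 0) * w (Sum.inr 1) - v (Sum.inr 1) * w (Sum.inr 0)) -
    δ * v (Sum.inr 0) * v (Sum.inr 1) *
      (w (Sum.inl 0) * w' (Sum.inl 1) - w' (Sum.inl 0) * w (Sum.inl 1))

theorem frame_add {δ : ℕ} (a b a' b' : ℤ) {i j : Fin 2} {p : Total δ}
    (hX : p.val (Sum.inl i) ≠ 0) (hY : p.val (Sum.inr j) ≠ 0) :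
    frame δ (a + a') (b + b') i j p = frame δ a b i j p * frame δ a' b' i j p := by
  simp only [frame, zpow_add₀ hY]
  rw [show a + a' - (b + b') * wt δ j = (a - b * wt δ j) + (a' - b' * wt δ j) by ring,
    zpow_add₀ hX]
  ring

/-- This is the isomorphism of Λ²Ω¹ with 𝒪(δ - 2, -2) made explicit. Exchanging i with i' or j with
j' changes the sign of the area form, which (-1)^(i+j) absorbs; the right side no longer mentions
the chart. -/
theorem frame_mul_contractArea_ratCoordDeriv {δ : ℕ} {i j : Fin 2} {p : Total δ}
    (hX : p.val (Sum.inl i) ≠ 0) (hY : p.val (Sum.inr j) ≠ 0) (w w' : Var → ℂ) :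
    (-1) ^ (i.val + j.val) * frame δ (2 - δ) 2 i j p *
      contractArea (ratCoordDeriv δ i j p.val w) (ratCoordDeriv δ i j p.val w') =
        radialArea δ p.val w w' := by
  have hz : p.val (Sum.inl i) ^ ((2 : ℤ) - δ - 2 * wt δ j) *
      p.val (Sum.inl i) ^ (wt δ j - wt δ j.rev) = p.val (Sum.inl i) ^ 2 := by
    rw [← zpow_add₀ hX, ← zpow_natCast]
    congr 1
    fin_cases j <;> simp [wt]
    ring
  have hf : frame δ (2 - δ) 2 i j p * p.val (Sum.inl i) ^ (wt δ j - wt δ j.rev) =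
      p.val (Sum.inl i) ^ 2 * p.val (Sum.inr j) ^ 2 := by
    rw [← hz, frame]
    norm_cast
    ring
  -- The integer power of X_i is moved out of the second components, where it meets the frame and
  -- becomes an ordinary square; the four cases are then identities of rational functions.
  have hsplit : (-1) ^ (i.val + j.val) * frame δ (2 - δ) 2 i j p *
      contractArea (ratCoordDeriv δ i j p.val w) (ratCoordDeriv δ i j p.val w') =
      (-1) ^ (i.val + j.val) * (frame δ (2 - δ) 2 i j p *
        p.val (Sum.inl i) ^ (wt δ j - wt δ j.rev)) *
      contractArea
        ((ratCoordDeriv δ i j p.val w).1, (ratCoordDeriv δ i j p.val w).2 /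
          p.val (Sum.inl i) ^ (wt δ j - wt δ j.rev))
        ((ratCoordDeriv δ i j p.val w').1, (ratCoordDeriv δ i j p.val w').2 /
          p.val (Sum.inl i) ^ (wt δ j - wt δ j.rev)) := by
    have := zpow_ne_zero (wt δ j - wt δ j.rev) hX
    simp only [contractArea_apply]
    field_simp
  rw [hsplit, hf]
  simp only [contractArea_apply, ratCoordDeriv, radialArea,
    mul_div_cancel_left₀ _ (zpow_ne_zero (wt δ j - wt δ j.rev) hX)]
  fin_cases i <;> fin_cases j <;> simp [wt] at hX hY ⊢ <;> field_simp <;> ring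

/-- The witness is tangent to the locus where X_i and Y_j are constant; there the differential is
diagonal. -/
theorem exists_ratCoordDeriv_eq (δ : ℕ) {i j : Fin 2} {v : Var → ℂ}
    (hX : v (Sum.inl i) ≠ 0) (hY : v (Sum.inr j) ≠ 0) (z : ℂ × ℂ) :
    ∃ w, ratCoordDeriv δ i j v w = z := by
  refine ⟨Sum.elim (fun k => if k = i then 0 else z.1 * v (Sum.inl i))
    (fun k => if k = j then 0 else
      z.2 * v (Sum.inr j) / v (Sum.inl i) ^ (wt δ j - wt δ j.rev)), ?_⟩
  have := zpow_ne_zero (wt δ j - wt δ j.rev) hX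
  refine Prod.ext ?_ ?_
  · simp [ratCoordDeriv, rev_ne]
    field_simp
  · simp [ratCoordDeriv, rev_ne]
    field_simp

/-- The chain rule for `ratCoord δ k l = transition δ i j k l ∘ ratCoord δ i j`. -/
theorem fderiv_transition_ratCoordDeriv {δ : ℕ} {i j k l : Fin 2} {p : Total δ}
    (hp : proj p ∈ affineOpen δ i j ∩ affineOpen δ k l) (w : Var → ℂ) :
    fderiv ℂ (transition δ i j k l) (ratCoord δ i j p.val) (ratCoordDeriv δ i j p.val w) =
      ratCoordDeriv δ k l p.val w := by
  obtain ⟨hX, hY⟩ := (proj_mem_affineOpen i j p).1 hp.1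
  obtain ⟨hX', hY'⟩ := (proj_mem_affineOpen k l p).1 hp.2
  have hT : DifferentiableAt ℂ (transition δ i j k l) (ratCoord δ i j p.val) := by
    have hs : proj (slicePoint δ i j (ratCoord δ i j p.val)) = proj p :=
      (chart δ i j).left_inv hp.1
    obtain ⟨h1, h2⟩ := (proj_mem_affineOpen k l _).1 (hs ▸ hp.2)
    exact DifferentiableAt.comp (g := ratCoord δ k l) (f := slice i j) _
      (differentiableAt_ratCoord δ h1 h2) (differentiable_slice i j _)
  have heq : ratCoord δ k l =ᶠ[nhds p.val] transition δ i j k l ∘ ratCoord δ i j := by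
    have hc : ∀ m : Var, ContinuousAt (fun v : Var → ℂ => v m) p.val :=
      fun m => (continuous_apply m).continuousAt
    filter_upwards [(hc _).eventually_ne hX, (hc _).eventually_ne hY] with v h1 h2
    let q : Total δ := ⟨v, ⟨i, h1⟩, ⟨j, h2⟩⟩
    have hs : proj (slicePoint δ i j (ratCoord δ i j v)) = proj q :=
      (chart δ i j).left_inv ((proj_mem_affineOpen i j q).2 ⟨h1, h2⟩)
    exact (congrArg (chart δ k l) hs).symm
  rw [← fderiv_ratCoord δ hX' hY', heq.fderiv_eq,
    fderiv_comp _ hT (differentiableAt_ratCoord δ hX hY), ← fderiv_ratCoord δ hX hY]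
  rfl

/-! ### Gluing the pulled-back form -/

/-- The pull-back to `π⁻¹(U_ij)` of the twisted `1`-form that annihilates `s`. -/
noncomputable def pulledForm {δ : ℕ} (d₁ d₂ : ℤ) (s : Fin 2 → Fin 2 → ℂ × ℂ → ℂ × ℂ)
    (i j : Fin 2) (p : Total δ) (w : Var → ℂ) : ℂ :=
  (-1) ^ (i.val + j.val) * frame δ (d₁ + 2 - δ) (d₂ + 2) i j p *
    contractArea (s i j (ratCoord δ i j p.val)) (ratCoordDeriv δ i j p.val w)

/-- The vector `c • v` is a lift of the twisted field to (ℂ²∖0)², so the form is the contraction of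
`radialArea` with it. The chart enters only through the lifting condition. -/
theorem pulledForm_eq_radialArea {δ : ℕ} (d₁ d₂ : ℤ) {s : Fin 2 → Fin 2 → ℂ × ℂ → ℂ × ℂ}
    {i j : Fin 2} {p : Total δ} (hp : proj p ∈ affineOpen δ i j) {c : ℂ} {v : Var → ℂ}
    (hv : c • ratCoordDeriv δ i j p.val v =
      frame δ d₁ d₂ i j p • s i j (ratCoord δ i j p.val)) (w : Var → ℂ) :
    pulledForm d₁ d₂ s i j p w = c * radialArea δ p.val v w := by
  obtain ⟨hX, hY⟩ := (proj_mem_affineOpen i j p).1 hp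
  have h := congrArg (fun z => contractArea z (ratCoordDeriv δ i j p.val w)) hv
  simp only [contractArea_smul, smul_apply, smul_eq_mul] at h
  rw [← frame_mul_contractArea_ratCoordDeriv hX hY, pulledForm, add_sub_assoc,
    frame_add _ _ _ _ hX hY]
  linear_combination (-(-1) ^ (i.val + j.val) * frame δ (2 - δ) 2 i j p) * h

theorem pulledForm_eq {δ : ℕ} {d₁ d₂ : ℤ} (s : twistedFields δ d₁ d₂) {i j k l : Fin 2}
    {p : Total δ} (hp : proj p ∈ affineOpen δ i j) (hp' : proj p ∈ affineOpen δ k l)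
    (w : Var → ℂ) : pulledForm d₁ d₂ s.1 i j p w = pulledForm d₁ d₂ s.1 k l p w := by
  obtain ⟨hX, hY⟩ := (proj_mem_affineOpen i j p).1 hp
  obtain ⟨v, hv⟩ := exists_ratCoordDeriv_eq δ hX hY (s.1 i j (ratCoord δ i j p.val))
  -- The same `c` and `v` serve both charts: the compatibility of `s` and the chain rule show that a
  -- lift found over U_ij is also a lift over U_kl.
  rw [pulledForm_eq_radialArea d₁ d₂ hp (c := frame δ d₁ d₂ i j p) (v := v) (by rw [hv]),
    pulledForm_eq_radialArea d₁ d₂ hp' (c := frame δ d₁ d₂ i j p) (v := v)]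
  have := s.2.2 i j k l p ⟨hp, hp'⟩
  rw [chart_proj, chart_proj, ← hv, fderiv_transition_ratCoordDeriv ⟨hp, hp'⟩] at this
  exact this

/-! ### Homogeneity, restriction to slices and radial fields -/

/-- Multiplying by X₀ Y₀ makes both sides vanish at the points of ℂ⁴ where X₀ or Y₀ is zero, in
particular at those outside (ℂ²∖0)². -/
theorem eq_of_eval_eq {δ : ℕ} {P Q : Poly}
    (h : ∀ p : Total δ, MvPolynomial.eval p.val P = MvPolynomial.eval p.val Q) : P = Q := by
  have key : MvPolynomial.X (Sum.inl 0) * MvPolynomial.X (Sum.inr 0) * P =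
      MvPolynomial.X (Sum.inl 0) * MvPolynomial.X (Sum.inr 0) * Q := by
    refine MvPolynomial.funext fun v => ?_
    simp only [map_mul, MvPolynomial.eval_X]
    by_cases hX : v (Sum.inl 0) = 0
    · simp [hX]
    by_cases hY : v (Sum.inr 0) = 0
    · simp [hY]
    rw [h ⟨v, ⟨0, hX⟩, ⟨0, hY⟩⟩]
  exact mul_left_cancel₀ (mul_ne_zero (MvPolynomial.X_ne_zero _) (MvPolynomial.X_ne_zero _)) key

/-- The bi-degree of a variable, first component. -/
def varDegree₁ (δ : ℕ) : Var → ℤ := Sum.elim (fun _ => 1) (wt δ)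

/-- The bi-degree of a variable, second component. -/
def varDegree₂ : Var → ℤ := Sum.elim (fun _ => 0) (fun _ => 1)

/-- The character by which the torus acts on a variable. -/
noncomputable def varChar (δ : ℕ) (g : ℂˣ × ℂˣ) (k : Var) : ℂ :=
  (g.1 : ℂ) ^ varDegree₁ δ k * (g.2 : ℂ) ^ varDegree₂ k

theorem varChar_ne_zero (δ : ℕ) (g : ℂˣ × ℂˣ) (k : Var) : varChar δ g k ≠ 0 :=
  mul_ne_zero (zpow_ne_zero _ g.1.ne_zero) (zpow_ne_zero _ g.2.ne_zero)

/-- The four bi-degrees follow one rule: Ω has total bi-degree (d₁ + 2 - δ, d₂ + 2), from which the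
bi-degree of the variable is subtracted. -/
theorem isFoliationForm_iff {δ : ℕ} {d₁ d₂ : ℤ} {Ω : AffineForm} :
    IsFoliationForm δ d₁ d₂ Ω ↔ Ω ≠ 0 ∧
      (∀ k, IsBihomogeneous δ (d₁ + 2 - δ - varDegree₁ δ k) (d₂ + 2 - varDegree₂ k) (Ω k)) ∧
      contract Ω (radial₁ δ) = 0 ∧ contract Ω radial₂ = 0 := by
  have e1 : d₁ + 2 - δ - 1 = d₁ - δ + 1 := by ring
  have e2 : d₁ + 2 - δ = d₁ - δ + 2 := by ring
  have e3 : d₁ + 2 - δ + δ = d₁ + 2 := by ring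
  have e4 : d₂ + 2 - 1 = d₂ + 1 := by ring
  have hdeg : (∀ k, IsBihomogeneous δ (d₁ + 2 - δ - varDegree₁ δ k) (d₂ + 2 - varDegree₂ k)
      (Ω k)) ↔ (IsBihomogeneous δ (d₁ - δ + 1) (d₂ + 2) (Ω (Sum.inl 0)) ∧
        IsBihomogeneous δ (d₁ - δ + 1) (d₂ + 2) (Ω (Sum.inl 1))) ∧
        IsBihomogeneous δ (d₁ - δ + 2) (d₂ + 1) (Ω (Sum.inr 0)) ∧
        IsBihomogeneous δ (d₁ + 2) (d₂ + 1) (Ω (Sum.inr 1)) := by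
    simp [Sum.forall, Fin.forall_fin_two, varDegree₁, varDegree₂, wt, e1, e3, e4]
    -- Used separately, since the left side of `e2` occurs inside those of `e1` and `e3`.
    simp [e2]
  rw [hdeg]
  exact ⟨fun h => ⟨h.1, ⟨⟨h.2, h.3⟩, h.4, h.5⟩, h.6, h.7⟩,
    fun ⟨h1, ⟨⟨h2, h3⟩, h4, h5⟩, h6, h7⟩ => ⟨h1, h2, h3, h4, h5, h6, h7⟩⟩

theorem IsFoliationForm.isBihomogeneous {δ : ℕ} {d₁ d₂ : ℤ} {Ω : AffineForm}
    (h : IsFoliationForm δ d₁ d₂ Ω) (k : Var) :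
    IsBihomogeneous δ (d₁ + 2 - δ - varDegree₁ δ k) (d₂ + 2 - varDegree₂ k) (Ω k) :=
  (isFoliationForm_iff.1 h).2.1 k

/-- The affine coordinates are invariant under the torus, whose action has the diagonal differential
`varChar`. -/
theorem ratCoordDeriv_smul {δ : ℕ} {i j : Fin 2} (g : ℂˣ × ℂˣ) {p : Total δ}
    (hp : proj p ∈ affineOpen δ i j) (w : Var → ℂ) :
    ratCoordDeriv δ i j (g • p).val (fun k => varChar δ g k * w k) =
      ratCoordDeriv δ i j p.val w := by
  obtain ⟨hX, hY⟩ := (proj_mem_affineOpen i j p).1 hp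
  have h1 : (g.1 : ℂ) ≠ 0 := g.1.ne_zero
  have h2 : (g.2 : ℂ) ≠ 0 := g.2.ne_zero
  have h3 : (g.1 : ℂ) ^ (wt δ j) ≠ 0 := zpow_ne_zero _ h1
  have h4 : (g.1 : ℂ) ^ (wt δ j.rev) ≠ 0 := zpow_ne_zero _ h1
  simp only [ratCoordDeriv, smul_inl, smul_inr, mul_zpow, zpow_sub₀ h1, varChar, varDegree₁,
    varDegree₂, Sum.elim_inl, Sum.elim_inr, zpow_zero, zpow_one, mul_one]
  refine Prod.ext ?_ ?_
  · dsimp only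
    rw [← mul_div_mul_left _ (p.val (Sum.inl i) ^ 2) (pow_ne_zero 2 h1)]
    ring
  · dsimp only
    field_simp

theorem ratCoordDeriv_slice (δ : ℕ) (i j : Fin 2) (z : ℂ × ℂ) (w : Var → ℂ) :
    ratCoordDeriv δ i j (slice i j z) w =
      (w (Sum.inl i.rev) - z.1 * w (Sum.inl i),
        w (Sum.inr j.rev) - z.2 * w (Sum.inr j) +
          ((wt δ j - wt δ j.rev : ℤ) : ℂ) * z.2 * w (Sum.inl i)) := by
  simp [ratCoordDeriv, slice, rev_ne]

theorem frame_slicePoint (δ : ℕ) (a b : ℤ) (i j : Fin 2) (z : ℂ × ℂ) :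
    frame δ a b i j (slicePoint δ i j z) = 1 := by
  simp [frame, slicePoint, slice]

theorem slicePoint_mem (δ : ℕ) (i j : Fin 2) (z : ℂ × ℂ) :
    proj (slicePoint δ i j z) ∈ affineOpen δ i j :=
  (chart δ i j).map_target (Set.mem_univ z)

theorem proj_smul {δ : ℕ} (g : ℂˣ × ℂˣ) (p : Total δ) : proj (g • p) = proj p :=
  Quotient.sound ⟨g, rfl⟩

theorem pulledForm_smul {δ : ℕ} (d₁ d₂ : ℤ) (s : Fin 2 → Fin 2 → ℂ × ℂ → ℂ × ℂ) {i j : Fin 2}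
    (g : ℂˣ × ℂˣ) {p : Total δ} (hp : proj p ∈ affineOpen δ i j) (w : Var → ℂ) :
    pulledForm d₁ d₂ s i j (g • p) (fun k => varChar δ g k * w k) =
      (g.1 : ℂ) ^ (d₁ + 2 - δ) * (g.2 : ℂ) ^ (d₂ + 2) * pulledForm d₁ d₂ s i j p w := by
  simp only [pulledForm, ratCoordDeriv_smul g hp, ratCoord_smul, frame_smul]
  ring

theorem pulledForm_slicePoint {δ : ℕ} (d₁ d₂ : ℤ) (s : Fin 2 → Fin 2 → ℂ × ℂ → ℂ × ℂ)
    (i j : Fin 2) (z : ℂ × ℂ) (w : Var → ℂ) :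
    pulledForm d₁ d₂ s i j (slicePoint δ i j z) w = (-1) ^ (i.val + j.val) *
      contractArea (s i j z) (w (Sum.inl i.rev) - z.1 * w (Sum.inl i),
        w (Sum.inr j.rev) - z.2 * w (Sum.inr j) +
          ((wt δ j - wt δ j.rev : ℤ) : ℂ) * z.2 * w (Sum.inl i)) := by
  rw [pulledForm, frame_slicePoint, mul_one, ← ratCoordDeriv_slice]
  change _ * contractArea (s i j (ratCoord δ i j (slice i j z))) _ = _
  rw [ratCoord_slice]
  rfl

theorem pulledForm_linear {δ : ℕ} (d₁ d₂ : ℤ) (s : Fin 2 → Fin 2 → ℂ × ℂ → ℂ × ℂ)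
    {i j : Fin 2} {p : Total δ} (hp : proj p ∈ affineOpen δ i j) :
    ∃ f : (Var → ℂ) →ₗ[ℂ] ℂ, ∀ w, pulledForm d₁ d₂ s i j p w = f w := by
  obtain ⟨hX, hY⟩ := (proj_mem_affineOpen i j p).1 hp
  refine ⟨((-1) ^ (i.val + j.val) * frame δ (d₁ + 2 - δ) (d₂ + 2) i j p) •
    ((contractArea (s i j (ratCoord δ i j p.val))).comp
      (fderiv ℂ (ratCoord δ i j) p.val)).toLinearMap, fun w => ?_⟩
  simp [pulledForm, fderiv_ratCoord δ hX hY]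

theorem evalForm_radial (Ω : AffineForm) (V : Var → Poly) (v : Var → ℂ) :
    MvPolynomial.eval v (contract Ω V) = evalForm Ω v fun k => MvPolynomial.eval v (V k) := by
  simp [contract, evalForm]

theorem ratCoordDeriv_radial₁ (δ : ℕ) {i j : Fin 2} {v : Var → ℂ}
    (hX : v (Sum.inl i) ≠ 0) (hY : v (Sum.inr j) ≠ 0) :
    ratCoordDeriv δ i j v (fun k => MvPolynomial.eval v (radial₁ δ k)) = 0 := by
  refine Prod.ext ?_ ?_
  · simp [ratCoordDeriv, radial₁, mul_comm]
  · refine mul_eq_zero_of_right _ ?_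
    fin_cases j <;> simp [radial₁, wt] at hY ⊢ <;> field_simp <;> simp

theorem ratCoordDeriv_radial₂ (δ : ℕ) {i j : Fin 2} {v : Var → ℂ}
    (hY : v (Sum.inr j) ≠ 0) :
    ratCoordDeriv δ i j v (fun k => MvPolynomial.eval v (radial₂ k)) = 0 := by
  refine Prod.ext ?_ ?_
  · simp [ratCoordDeriv, radial₂]
  · refine mul_eq_zero_of_right _ ?_
    simp [radial₂]
    field_simp
    simp

theorem evalForm_single (Ω : AffineForm) (v : Var → ℂ) (k : Var) :
    evalForm Ω v (Pi.single k 1) = MvPolynomial.eval v (Ω k) := by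
  simp [evalForm, Pi.single_apply]

/-- On the slice the frame is 1 and the coordinate vectors of X_i' and Y_j' map to ∂/∂x and ∂/∂y. -/
theorem localForm_of_evalForm_eq {δ : ℕ} {d₁ d₂ : ℤ} {s : Fin 2 → Fin 2 → ℂ × ℂ → ℂ × ℂ}
    {Ω : AffineForm} {i j : Fin 2} (h : ∀ p : Total δ, proj p ∈ affineOpen δ i j → ∀ w,
      evalForm Ω p.val w = pulledForm d₁ d₂ s i j p w) (z : ℂ × ℂ) :
    localForm Ω i j z = ((-1) ^ (i.val + j.val) : ℂ) • contractArea (s i j z) := by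
  have hk : ∀ k, dehom i j (Ω k) z = _ := fun k =>
    (evalForm_single Ω _ k).symm.trans ((h _ (slicePoint_mem δ i j z) _).trans
      (pulledForm_slicePoint d₁ d₂ s i j z _))
  ext <;> simp [localForm, hk, contractArea_apply, (rev_ne _).symm]

theorem contractArea_injective : Function.Injective contractArea := by
  intro w w' h
  have h1 := congrArg (fun f => f (0, 1)) h
  have h2 := congrArg (fun f => f (1, 0)) h
  simp only [contractArea_apply, mul_zero, mul_one, sub_zero, zero_sub, neg_inj] at h1 h2
  exact Prod.ext h1 h2

/-! ### Existence of the form -/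

/-- The coefficients are the values of the glued form on the coordinate vectors. Non-vanishing holds
because the local forms determine `s`. -/
theorem exists_foliationForm {δ : ℕ} {d₁ d₂ : ℤ} (s : twistedFields δ d₁ d₂) (hs : s ≠ 0) :
    ∃ Ω, IsFoliationForm δ d₁ d₂ Ω ∧ ∀ (i j : Fin 2) (p : Total δ), proj p ∈ affineOpen δ i j →
      ∀ w, evalForm Ω p.val w = pulledForm d₁ d₂ s.1 i j p w := by
  -- An arbitrary chart at each point; by `pulledForm_eq` the choice is immaterial.
  choose ci cj hc using exists_mem_affineOpen (δ := δ)
  have hsec : ∀ k, IsGlobalSection δ (d₁ + 2 - δ - varDegree₁ δ k) (d₂ + 2 - varDegree₂ k)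
      fun p => pulledForm d₁ d₂ s.1 (ci p) (cj p) p (Pi.single k 1) := by
    intro k
    refine ⟨fun g p => ?_, fun i j => ?_⟩
    · have hp : proj p ∈ affineOpen δ (ci (g • p)) (cj (g • p)) := proj_smul g p ▸ hc (g • p)
      rw [pulledForm_eq s (hc p) hp]
      obtain ⟨f, hf⟩ := pulledForm_linear d₁ d₂ s.1 (hc (g • p))
      have := pulledForm_smul d₁ d₂ s.1 g hp (Pi.single k 1)
      -- A coordinate vector is an eigenvector of the torus, which lowers the bi-degree of the
      -- coefficient by that of the variable.
      have hw : (fun l => varChar δ g l * (Pi.single k 1 : Var → ℂ) l) =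
          varChar δ g k • Pi.single k 1 := by
        funext l
        rcases eq_or_ne l k with rfl | hl <;> simp [*]
      rw [hw, hf, map_smul, ← hf] at this
      refine mul_left_cancel₀ (varChar_ne_zero δ g k) ?_
      rw [← smul_eq_mul, this]
      generalize d₁ + 2 - (δ : ℤ) = D, d₂ + 2 = E
      rw [zpow_sub₀ g.1.ne_zero, zpow_sub₀ g.2.ne_zero, varChar]
      have h1 := zpow_ne_zero (varDegree₁ δ k) g.1.ne_zero
      have h2 := zpow_ne_zero (varDegree₂ k) g.2.ne_zero
      field_simp
    · have : (fun z => pulledForm d₁ d₂ s.1 (ci (slicePoint δ i j z))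
          (cj (slicePoint δ i j z)) (slicePoint δ i j z) (Pi.single k 1)) =
          fun z => pulledForm d₁ d₂ s.1 i j (slicePoint δ i j z) (Pi.single k 1) := by
        funext z
        exact pulledForm_eq s (hc _) (slicePoint_mem δ i j z) _
      rw [this]
      have hd := s.2.1 i j
      simp only [pulledForm_slicePoint, contractArea_apply]
      fun_prop
  choose Ω hΩ hΩe using fun k => (hsec k).exists_polynomial
  have heval : ∀ (i j : Fin 2) (p : Total δ), proj p ∈ affineOpen δ i j →
      ∀ w, evalForm Ω p.val w = pulledForm d₁ d₂ s.1 i j p w := by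
    intro i j p hp w
    obtain ⟨f, hf⟩ := pulledForm_linear d₁ d₂ s.1 hp
    rw [hf, LinearMap.pi_apply_eq_sum_univ f w, evalForm]
    refine Finset.sum_congr rfl fun k _ => ?_
    rw [hΩe, pulledForm_eq s (hc p) hp, hf, smul_eq_mul, mul_comm]
    congr 2
    funext l
    simp [Pi.single_apply, eq_comm]
  refine ⟨Ω, isFoliationForm_iff.2 ⟨?_, hΩ, ?_, ?_⟩, heval⟩
  · rintro rfl
    refine hs (Subtype.ext ?_)
    funext i j z
    have := localForm_of_evalForm_eq (heval i j) z
    have h0 : contractArea (s.1 i j z) = 0 := (smul_eq_zero.1 (this.symm.trans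
      (by ext <;> simp [localForm, dehom]))).resolve_left (by simp)
    exact contractArea_injective (h0.trans (by ext <;> simp [contractArea]))
  · refine eq_of_eval_eq (δ := δ) fun p => ?_
    obtain ⟨hX, hY⟩ := (proj_mem_affineOpen _ _ p).1 (hc p)
    rw [evalForm_radial, heval _ _ p (hc p), pulledForm, ratCoordDeriv_radial₁ δ hX hY]
    simp
  · refine eq_of_eval_eq (δ := δ) fun p => ?_
    obtain ⟨hX, hY⟩ := (proj_mem_affineOpen _ _ p).1 (hc p)
    rw [evalForm_radial, heval _ _ p (hc p), pulledForm, ratCoordDeriv_radial₂ δ hY]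
    simp

/-! ### Locally proportional forms are proportional -/

theorem eq_mul_of_linear_relation {i : Fin 2} {x c t t' : ℂ} {a a' : Fin 2 → ℂ}
    (h : (if 0 = i then 1 else x) * a 0 + (if 1 = i then 1 else x) * a 1 = t)
    (h' : (if 0 = i then 1 else x) * a' 0 + (if 1 = i then 1 else x) * a' 1 = t')
    (ht : t' = c * t) (ha : a' i.rev = c * a i.rev) : a' i = c * a i := by
  subst h h'
  fin_cases i
  · change a' 1 = c * a 1 at ha
    simp [ha] at ht ⊢
    linear_combination ht
  · change a' 0 = c * a 0 at ha
    simp [ha] at ht ⊢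
    linear_combination ht

/-- A local form contains only the coefficients of index i' and j'. On the slice X_i = Y_j = 1, so
the radial relations can be solved for the other two; equal bi-degrees spread the proportionality
over π⁻¹(U_ij). -/
theorem eval_eq_mul_of_localForm_eq {δ : ℕ} {d₁ d₂ : ℤ} {Ω Ω' : AffineForm}
    (hΩ : IsFoliationForm δ d₁ d₂ Ω) (hΩ' : IsFoliationForm δ d₁ d₂ Ω') {i j : Fin 2}
    {u : ℂ × ℂ → ℂ} (hu : ∀ z, localForm Ω' i j z = u z • localForm Ω i j z) {p : Total δ}
    (hp : proj p ∈ affineOpen δ i j) (k : Var) :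
    MvPolynomial.eval p.val (Ω' k) =
      u (ratCoord δ i j p.val) * MvPolynomial.eval p.val (Ω k) := by
  obtain ⟨g, hg⟩ := exists_smul_slicePoint hp
  set z := ratCoord δ i j p.val
  suffices h : ∀ k, MvPolynomial.eval (slice i j z) (Ω' k) =
      u z * MvPolynomial.eval (slice i j z) (Ω k) by
    rw [← hg, (hΩ'.isBihomogeneous k).eval_smul, (hΩ.isBihomogeneous k).eval_smul]
    change _ * MvPolynomial.eval (slice i j z) (Ω' k) =
      _ * (_ * MvPolynomial.eval (slice i j z) (Ω k))
    rw [h]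
    ring
  have hA := congrArg (fun f => f (1, 0)) (hu z)
  have hB := congrArg (fun f => f (0, 1)) (hu z)
  simp [localForm, dehom] at hA hB
  have r1 := hΩ.radial₁
  have r1' := hΩ'.radial₁
  have r2 := hΩ.radial₂
  have r2' := hΩ'.radial₂
  rw [contract_radial₁] at r1 r1'
  rw [contract_radial₂] at r2 r2'
  replace r1 := congrArg (MvPolynomial.eval (slice i j z)) r1
  replace r2 := congrArg (MvPolynomial.eval (slice i j z)) r2
  replace r1' := congrArg (MvPolynomial.eval (slice i j z)) r1'
  replace r2' := congrArg (MvPolynomial.eval (slice i j z)) r2'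
  simp only [map_add, map_sub, map_mul, map_zero, map_natCast, MvPolynomial.eval_X]
    at r1 r1' r2 r2'
  -- The relation for R₂ comes first, because the one for R₁ involves B₁.
  have hBj : MvPolynomial.eval (slice i j z) (Ω' (Sum.inr j)) =
      u z * MvPolynomial.eval (slice i j z) (Ω (Sum.inr j)) :=
    eq_mul_of_linear_relation (a := fun k => MvPolynomial.eval (slice i j z) (Ω (Sum.inr k)))
      (a' := fun k => MvPolynomial.eval (slice i j z) (Ω' (Sum.inr k))) r2 r2' (by simp) hB
  have hB1 : MvPolynomial.eval (slice i j z) (Ω' (Sum.inr 1)) =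
      u z * MvPolynomial.eval (slice i j z) (Ω (Sum.inr 1)) := by
    fin_cases j
    · exact hB
    · exact hBj
  have hAi : MvPolynomial.eval (slice i j z) (Ω' (Sum.inl i)) =
      u z * MvPolynomial.eval (slice i j z) (Ω (Sum.inl i)) :=
    eq_mul_of_linear_relation (a := fun k => MvPolynomial.eval (slice i j z) (Ω (Sum.inl k)))
      (a' := fun k => MvPolynomial.eval (slice i j z) (Ω' (Sum.inl k)))
      (sub_eq_zero.1 r1) (sub_eq_zero.1 r1') (by rw [hB1]; ring) hA
  rintro (k | k)
  · rcases eq_or_ne k i with rfl | hk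
    · exact hAi
    · exact eq_rev_of_ne hk ▸ hA
  · rcases eq_or_ne k j with rfl | hk
    · exact hBj
    · exact eq_rev_of_ne hk ▸ hB

/-- On the complex line joining any `v` to a point `w` where `Q` is non-zero, `Q` is a non-zero
polynomial in one variable, with finitely many roots. -/
theorem dense_eval_ne_zero {Q : Poly} (hQ : Q ≠ 0) :
    Dense {v : Var → ℂ | MvPolynomial.eval v Q ≠ 0} := by
  obtain ⟨w, hw⟩ : ∃ w, MvPolynomial.eval w Q ≠ 0 := by
    by_contra! h
    exact hQ (MvPolynomial.funext fun v => by simp [h v])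
  intro v
  set q : Polynomial ℂ := MvPolynomial.aeval
    (fun k => Polynomial.C (v k) + Polynomial.X * Polynomial.C (w k - v k)) Q with hq
  have heval : ∀ t : ℂ, q.eval t = MvPolynomial.eval (v + t • (w - v)) Q := by
    intro t
    rw [hq, MvPolynomial.aeval_def, ← Polynomial.coe_evalRingHom, MvPolynomial.hom_eval₂,
      MvPolynomial.eval, MvPolynomial.coe_eval₂Hom]
    congr 1
    · ext; simp
    · funext k
      simp
  have hq0 : q ≠ 0 := by
    intro h0
    have := heval 1
    rw [h0] at this
    simp at this
    exact hw this.symm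
  have hd : Dense {t : ℂ | q.IsRoot t}ᶜ :=
    (Polynomial.finite_setOfPred_isRoot hq0).countable.dense_compl ℂ
  have hc : ContinuousAt (fun t : ℂ => v + t • (w - v)) 0 := by fun_prop
  have := mem_closure_image hc (hd 0)
  simp only [zero_smul, add_zero] at this
  refine closure_mono ?_ this
  rintro _ ⟨t, ht, rfl⟩
  simpa [Polynomial.IsRoot, heval] using ht

/-- Where Ω m ≠ 0 both factors equal the quotient of Ω' m by Ω m. At the zeros of Ω m the equality
follows by continuity. -/
theorem eq_of_localForm_eq {δ : ℕ} {d₁ d₂ : ℤ} {Ω Ω' : AffineForm}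
    (hΩ : IsFoliationForm δ d₁ d₂ Ω) (hΩ' : IsFoliationForm δ d₁ d₂ Ω')
    {u : Fin 2 → Fin 2 → ℂ × ℂ → ℂ} (hd : ∀ i j, Differentiable ℂ (u i j))
    (hu : ∀ i j z, localForm Ω' i j z = u i j z • localForm Ω i j z) {i j k l : Fin 2}
    {p : Total δ} (hp : proj p ∈ affineOpen δ i j) (hp' : proj p ∈ affineOpen δ k l) :
    u i j (ratCoord δ i j p.val) = u k l (ratCoord δ k l p.val) := by
  obtain ⟨m, hm⟩ : ∃ m, Ω m ≠ 0 := by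
    by_contra! h
    exact hΩ.ne_zero (funext h)
  -- The four variables in the product keep the dense set inside both charts.
  have hD := dense_eval_ne_zero (Q := MvPolynomial.X (Sum.inl i) * MvPolynomial.X (Sum.inr j) *
    (MvPolynomial.X (Sum.inl k) * MvPolynomial.X (Sum.inr l)) * Ω m)
    (by simp [MvPolynomial.X_ne_zero, hm])
  have hcont : ∀ {i j}, proj p ∈ affineOpen δ i j →
      ContinuousAt (fun v => u i j (ratCoord δ i j v)) p.val := by
    intro i j hp
    obtain ⟨hX, hY⟩ := (proj_mem_affineOpen i j p).1 hp
    exact (hd i j).continuous.continuousAt.comp (differentiableAt_ratCoord δ hX hY).continuousAt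
  have := mem_closure_iff_nhdsWithin_neBot.1 (hD p.val)
  refine @tendsto_nhds_unique _ _ _ _ _ _ _ _ this ((hcont hp).mono_left nhdsWithin_le_nhds)
    (((hcont hp').mono_left nhdsWithin_le_nhds).congr' ?_)
  filter_upwards [self_mem_nhdsWithin] with v hv
  simp only [map_mul, MvPolynomial.eval_X, mul_ne_zero_iff] at hv
  obtain ⟨⟨⟨hi, hj⟩, hk, hl⟩, hv⟩ := hv
  let q : Total δ := ⟨v, ⟨i, hi⟩, ⟨j, hj⟩⟩
  refine mul_right_cancel₀ hv ?_
  rw [← eval_eq_mul_of_localForm_eq hΩ hΩ' (hu k l) (p := q)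
      ((proj_mem_affineOpen k l q).2 ⟨hk, hl⟩) m,
    ← eval_eq_mul_of_localForm_eq hΩ hΩ' (hu i j) (p := q)
      ((proj_mem_affineOpen i j q).2 ⟨hi, hj⟩) m]

theorem IsBihomogeneous.eq_C {δ : ℕ} {P : Poly} (hP : IsBihomogeneous δ 0 0 P) :
    P = MvPolynomial.C (P.coeff 0) := by
  ext m
  rw [MvPolynomial.coeff_C]
  split_ifs with h
  · rw [h]
  · by_contra hm
    obtain ⟨h1, h2⟩ := hP m hm
    have hε : m (Sum.inr 1) = 0 := by omega
    simp only [hε, Nat.cast_zero, mul_zero, sub_zero] at h1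
    refine h (Finsupp.ext ?_)
    rintro (k | k) <;> fin_cases k <;> simp <;> omega

/-- Two foliation forms with locally proportional restrictions are proportional. -/
theorem IsFoliationForm.exists_eq_smul {δ : ℕ} {d₁ d₂ : ℤ} {Ω Ω' : AffineForm}
    (hΩ : IsFoliationForm δ d₁ d₂ Ω) (hΩ' : IsFoliationForm δ d₁ d₂ Ω')
    {u : Fin 2 → Fin 2 → ℂ × ℂ → ℂ} (hd : ∀ i j, Differentiable ℂ (u i j))
    (hu : ∀ i j z, localForm Ω' i j z = u i j z • localForm Ω i j z) :
    ∃ c : ℂ, c ≠ 0 ∧ Ω' = c • Ω := by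
  choose ci cj hc using exists_mem_affineOpen (δ := δ)
  -- The local factors glue to a global function on the surface, hence to a polynomial of bi-degree
  -- (0, 0), a constant.
  have hsec : IsGlobalSection δ 0 0
      fun p => u (ci p) (cj p) (ratCoord δ (ci p) (cj p) p.val) := by
    refine ⟨fun g p => ?_, fun i j => ?_⟩
    · have hp : proj p ∈ affineOpen δ (ci (g • p)) (cj (g • p)) := proj_smul g p ▸ hc (g • p)
      rw [ratCoord_smul, eq_of_localForm_eq hΩ hΩ' hd hu hp (hc p)]
      simp
    · convert hd i j using 1
      funext z
      rw [eq_of_localForm_eq hΩ hΩ' hd hu (hc _) (slicePoint_mem δ i j z)]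
      exact congrArg (u i j) (ratCoord_slice δ i j z)
  obtain ⟨P, hP, hPe⟩ := hsec.exists_polynomial
  have heq : Ω' = P.coeff 0 • Ω := by
    funext k
    refine eq_of_eval_eq (δ := δ) fun p => ?_
    rw [eval_eq_mul_of_localForm_eq hΩ hΩ' (hu _ _) (hc p) k, ← hPe p, hP.eq_C]
    simp
  refine ⟨P.coeff 0, fun h0 => hΩ'.ne_zero ?_, heq⟩
  rw [heq, h0, zero_smul]

theorem contract_smul (c : ℂ) (Ω : AffineForm) (V : Var → Poly) :
    contract (c • Ω) V = c • contract Ω V := by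
  simp [contract]

theorem IsFoliationForm.smul {δ : ℕ} {d₁ d₂ : ℤ} {Ω : AffineForm}
    (hΩ : IsFoliationForm δ d₁ d₂ Ω) {c : ℂ} (hc : c ≠ 0) :
    IsFoliationForm δ d₁ d₂ (c • Ω) := by
  refine isFoliationForm_iff.2 ⟨smul_ne_zero hc hΩ.ne_zero, fun k m hm => ?_, ?_, ?_⟩
  · refine hΩ.isBihomogeneous k m fun h => hm ?_
    simp [h]
  · rw [contract_smul, hΩ.radial₁, smul_zero]
  · rw [contract_smul, hΩ.radial₂, smul_zero]

theorem localForm_smul (c : ℂ) (Ω : AffineForm) (i j : Fin 2) (z : ℂ × ℂ) :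
    localForm (c • Ω) i j z = c • localForm Ω i j z := by
  ext <;> simp [localForm, dehom]

end Hirzebruch

/-! ### The main theorem -/

theorem mainTheorem4 (δ : ℕ) (d₁ d₂ : ℤ) (F : Hirzebruch.Fol δ d₁ d₂) :
    ∃ Ω : Hirzebruch.AffineForm,
      Hirzebruch.IsFoliationForm δ d₁ d₂ Ω ∧
      Hirzebruch.Represents Ω F ∧
      (∀ i j : Fin 2, Hirzebruch.DefinesOn F i j (Hirzebruch.localForm Ω i j)) ∧
      (∀ Ω' : Hirzebruch.AffineForm,
        (Hirzebruch.IsFoliationForm δ d₁ d₂ Ω' ∧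
          ∀ i j : Fin 2, Hirzebruch.DefinesOn F i j (Hirzebruch.localForm Ω' i j)) ↔
        ∃ c : ℂ, c ≠ 0 ∧ Ω' = c • Ω) ∧
      (∀ F' : Hirzebruch.Fol δ d₁ d₂,
        (∀ i j : Fin 2, Hirzebruch.DefinesOn F' i j (Hirzebruch.localForm Ω i j)) → F' = F) := by
  open Hirzebruch in
  obtain ⟨Ω, hΩ, heval⟩ := exists_foliationForm F.rep F.rep_nonzero
  have hsign : ∀ i j : Fin 2, ((-1) ^ (i.val + j.val) : ℂ) ≠ 0 := by simp
  have hloc : ∀ i j z, localForm Ω i j z =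
      ((-1) ^ (i.val + j.val) : ℂ) • contractArea (F.rep.1 i j z) :=
    fun i j => localForm_of_evalForm_eq (heval i j)
  have hdef : ∀ c : ℂ, c ≠ 0 → ∀ i j, DefinesOn F i j (localForm (c • Ω) i j) := by
    intro c hc i j
    refine ⟨fun _ => c * (-1) ^ (i.val + j.val), differentiable_const _,
      fun _ => mul_ne_zero hc (hsign i j), fun z => ?_⟩
    rw [localForm_smul, hloc, smul_smul]
  refine ⟨Ω, hΩ, ⟨F.rep, F.rep_nonzero, F.mk_rep, fun i j p hp w => ?_⟩,
    fun i j => by simpa using hdef 1 one_ne_zero i j, fun Ω' => ⟨?_, ?_⟩, fun F' hF' => ?_⟩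
  · obtain ⟨hX, hY⟩ := (proj_mem_affineOpen i j p).1 hp
    rw [heval i j p hp, fderiv_ratCoord δ hX hY]
    rfl
  · rintro ⟨hΩ', hF⟩
    choose u hd _ hu using hF
    refine hΩ.exists_eq_smul hΩ' (u := fun i j z => u i j z * ((-1) ^ (i.val + j.val))⁻¹)
      (fun i j => (hd i j).mul_const _) fun i j z => ?_
    rw [hloc, smul_smul, hu, mul_assoc, inv_mul_cancel₀ (hsign i j), mul_one]
  · rintro ⟨c, hc, rfl⟩
    exact ⟨hΩ.smul hc, hdef c hc⟩
  -- The form of F' is locally proportional to Ω, hence equal to c • Ω; cancelling signs and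
  -- contraction gives c • `F.rep` = `F'.rep`.
  · obtain ⟨Ω', hΩ', heval'⟩ := exists_foliationForm F'.rep F'.rep_nonzero
    have hloc' : ∀ i j z, localForm Ω' i j z =
        ((-1) ^ (i.val + j.val) : ℂ) • contractArea (F'.rep.1 i j z) :=
      fun i j => localForm_of_evalForm_eq (heval' i j)
    choose u hd hu0 hu using hF'
    obtain ⟨c, -, rfl⟩ := hΩ.exists_eq_smul hΩ'
      (u := fun i j z => (-1) ^ (i.val + j.val) * (u i j z)⁻¹)
      (fun i j => ((hd i j).inv (hu0 i j)).const_mul _) fun i j z => by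
        rw [hloc', hu, smul_smul, mul_assoc, inv_mul_cancel₀ (hu0 i j z), mul_one]
    rw [← F'.mk_rep, ← F.mk_rep, Projectivization.mk_eq_mk_iff']
    refine ⟨c, Subtype.ext ?_⟩
    funext i j z
    have h := hloc' i j z
    rw [localForm_smul, hloc, smul_comm, ← contractArea_smul] at h
    exact contractArea_injective (smul_right_injective _ (hsign i j) h)
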